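/- Let $T$ be a sink tree on the vertex set $[n]$ with root $z$, i.e. a rooted tree with root $z$ all of whose edges are oriented toward $z$, and let $\tilde T$ be the source tree obtained from $T$ by reversing the orientation of every edge. For a digraph $D$ on $[n]$, a sequence $s\in[n]^m$ is a parking function on $D$ if it is possible for $m$ cars, entering one after another, all to park by the following rule: car $i$ starts at vertex $s_i$; whenever the vertex where a car currently stands is unoccupied it parks there, and otherwise it drives along an outgoing edge of its choice and repeats (failing to park if it never finds an unoccupied vertex). Let $P(D,m)$ be the number of parking functions with $m$ cars on $D$. Let $N(z)$ be the set of vertices adjacent to $z$, and let $\mathrm{minleafdist}(T)$ be the number of vertices (both ends included) in a shortest path, in the underlying undirected tree, from a leaf (a vertex of degree one) to a vertex of degree at least three, with $\mathrm{minleafdist}(T)=\infty$ if $T$ has no vertex of degree at least three. If $$2\le m\le \min\bigl(|N(z)|,\ \mathrm{minleafdist}(T)\bigr),$$ then $$P(T,m)>P(\tilde T,m).$$ -/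

import Mathlib

namespace DigraphParking

variable {V : Type*}

/-- `CarParks D occ u w`: when the occupied vertices are those of `occ`, a car that is currently at
`u` can end up parking at `w`. It parks where it is if that vertex is free; otherwise it drives
along some edge of `D` (of its choice) and repeats. -/
inductive CarParks (D : Digraph V) (occ : Set V) : V → V → Prop
  | park {u : V} (hu : u ∉ occ) : CarParks D occ u u
  | drive {u v w : V} (hu : u ∈ occ) (huv : D.Adj u v) (hw : CarParks D occ v w) :
      CarParks D occ u w

/-- `AllCarsPark D occ s`: starting from the occupied set `occ`, it is possible for the cars with
successive preferences `s` to park one after another. -/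
inductive AllCarsPark (D : Digraph V) : Set V → List V → Prop
  | nil (occ : Set V) : AllCarsPark D occ []
  | cons {occ : Set V} {u w : V} {s : List V} (hw : CarParks D occ u w)
      (hs : AllCarsPark D (insert w occ) s) : AllCarsPark D occ (u :: s)

/-- `s` is a parking function with `m` cars on `D`. -/
def IsParkingFunction (D : Digraph V) {m : ℕ} (s : Fin m → V) : Prop :=
  AllCarsPark D ∅ (List.ofFn s)

/-- `P(D, m)`: the number of parking functions with `m` cars on `D`. -/
noncomputable def numParking (D : Digraph V) (m : ℕ) : ℕ :=
  {s : Fin m → V | IsParkingFunction D s}.ncard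

/-- The digraph with all edges reversed. -/
def reversal (D : Digraph V) : Digraph V where
  Adj u v := D.Adj v u

/-- The underlying undirected graph. -/
abbrev underlying (D : Digraph V) : SimpleGraph V := D.toSimpleGraphInclusive

/-- `D` is a sink tree with root `z`: the underlying graph is a tree, and every edge is oriented
toward `z`, i.e. it leads from a vertex to one that is one step closer to `z`. -/
def IsSinkTree (D : Digraph V) (z : V) : Prop :=
  (underlying D).IsTree ∧
    ∀ u v, D.Adj u v → (underlying D).dist u z = (underlying D).dist v z + 1

/-- `N(v)`: the vertices adjacent to `v`, regardless of orientation. -/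
def nbhd (D : Digraph V) (v : V) : Set V := (underlying D).neighborSet v

/-- The (undirected) degree of a vertex. -/
noncomputable def deg (D : Digraph V) (v : V) : ℕ := (nbhd D v).ncard

/-- The number of vertices in a shortest path from a leaf to a vertex of degree at least three
(both ends counted); it is `⊤` if there is no vertex of degree at least three. -/
noncomputable def minleafdist (D : Digraph V) : ℕ∞ :=
  ⨅ (l : V) (_ : deg D l = 1) (v : V) (_ : 3 ≤ deg D v), (underlying D).edist l v + 1

end DigraphParking

/-!
A car that has to park early may take the place meant for a later car, which then drives on to the
place meant for the earlier one. So `s` is a parking function as soon as distinct vertices can be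
assigned to the cars such that each car can reach its vertex when all other cars are ignored.

Choose one child of every vertex other than the root `z` that has a child. This cuts the tree into
the chain `{z}` and vertical chains that end at leaves. Let `s` be a parking function on the source
tree. A set of fewer than `minleafdist T` vertices other than `z` that contains with every vertex
everything below it on its chain contains no vertex with two children, hence no car that starts in
it can leave it. By Hall's theorem the cars that do not start at `z` can therefore all park at or
below their starting points within their own chains. Turning all chains upside down turns these
sequences into those in which the cars not starting at `z` can park at or above their starting
points within their own chains.

On the sink tree, such a sequence is a parking function if at most one car starts at `z`. If at
least two do, some child `x` of `z` has a chain in which no car starts, and moving the cars from `z`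
to that chain, with two of them starting at `x`, gives a parking function on the sink tree that is
not of the above form and that determines both `s` and `x`. The inequality is strict because `x` can
be chosen in several ways when all cars start at `z`.
-/

namespace DigraphParking

open Relation Function

variable {V : Type*} {m : ℕ}

section Matching

variable {D : Digraph V} {occ : Set V} {u v w : V}

theorem CarParks.notMem (h : CarParks D occ u w) : w ∉ occ := by
  induction h with
  | park hu => exact hu
  | drive _ _ _ ih => exact ih

theorem CarParks.reflTransGen (h : CarParks D occ u w) : ReflTransGen D.Adj u w := by
  induction h with
  | park _ => exact .refl
  | drive _ huv _ ih => exact ih.head huv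

theorem exists_carParks_of_reflTransGen (huv : ReflTransGen D.Adj u v) (hv : v ∉ occ) :
    ∃ w, CarParks D occ u w ∧ ReflTransGen D.Adj w v := by
  induction huv using ReflTransGen.head_induction_on with
  | refl => exact ⟨v, .park hv, .refl⟩
  | @head a b hab hbv ih =>
    by_cases ha : a ∈ occ
    · obtain ⟨w, hw, hwv⟩ := ih
      exact ⟨w, .drive ha hab hw, hwv⟩
    · exact ⟨a, .park ha, hbv.head hab⟩

theorem AllCarsPark.exists_forall₂ {l : List V} (h : AllCarsPark D occ l) :
    ∃ l', List.Forall₂ (ReflTransGen D.Adj) l l' ∧ l'.Nodup ∧ ∀ w ∈ l', w ∉ occ := by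
  induction h with
  | nil occ => exact ⟨[], .nil, List.nodup_nil, by simp⟩
  | @cons occ u w l hw _ ih =>
    obtain ⟨l', hl, hnodup, hfree⟩ := ih
    refine ⟨w :: l', .cons hw.reflTransGen hl,
      List.nodup_cons.2 ⟨fun hmem => hfree w hmem (Set.mem_insert w occ), hnodup⟩, ?_⟩
    rintro x (_ | ⟨_, hx⟩)
    · exact hw.notMem
    · exact fun hocc => hfree x hx (Set.mem_insert_of_mem w hocc)

theorem allCarsPark_of_forall₂ {l l' : List V} (hl : List.Forall₂ (ReflTransGen D.Adj) l l')
    (hnodup : l'.Nodup) (hfree : ∀ w ∈ l', w ∉ occ) : AllCarsPark D occ l := by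
  classical
  induction l generalizing occ l' with
  | nil => exact .nil occ
  | cons u l ih =>
    obtain ⟨v, l', huv, htail, rfl⟩ := List.forall₂_cons_left_iff.1 hl
    obtain ⟨hv, hnodup⟩ := List.nodup_cons.1 hnodup
    obtain ⟨w, hw, hwv⟩ := exists_carParks_of_reflTransGen huv (hfree v List.mem_cons_self)
    -- A later car that was meant to park at `w` drives on to `v` instead.
    let reroute : V → V := fun x => if x = w then v else x
    refine .cons hw (ih (l' := l'.map reroute) ?_ ?_ ?_)
    · rw [List.forall₂_map_right_iff]
      refine htail.imp fun a x hax => ?_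
      by_cases hx : x = w
      · simpa only [reroute, if_pos hx] using (hx ▸ hax).trans hwv
      · simpa only [reroute, if_neg hx] using hax
    · exact hnodup.map_on fun x hx y hy hxy => by grind
    · intro y hy
      obtain ⟨x, hx, rfl⟩ := List.mem_map.1 hy
      grind

theorem isParkingFunction_iff_exists_injective {s : Fin m → V} :
    IsParkingFunction D s ↔
      ∃ f : Fin m → V, Injective f ∧ ∀ i, ReflTransGen D.Adj (s i) (f i) := by
  constructor
  · intro h
    obtain ⟨l, hl, hnodup, -⟩ := AllCarsPark.exists_forall₂ h
    obtain ⟨hlength, hreach⟩ := List.forall₂_iff_get.1 hl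
    rw [List.length_ofFn] at hlength
    refine ⟨fun i => l.get (i.cast hlength),
      (List.nodup_iff_injective_get.1 hnodup).comp (Fin.cast_injective hlength), fun i => ?_⟩
    simpa using hreach i (by simp) (by simp [← hlength])
  · rintro ⟨f, hf, hreach⟩
    refine allCarsPark_of_forall₂ (l' := List.ofFn f) ?_ (List.nodup_ofFn.2 hf)
      fun w _ => Set.notMem_empty w
    rw [List.forall₂_iff_get]
    exact ⟨by simp, fun i _ _ => by simpa using hreach _⟩

end Matching

theorem exists_perm_antitone_on_fibers [Finite V] {ι α : Type*} [LinearOrder α] (label : V → ι)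
    {h : V → α} (hinj : ∀ ⦃u v⦄, label u = label v → h u = h v → u = v) :
    ∃ ρ : Equiv.Perm V, (∀ v, label (ρ v) = label v) ∧
      ∀ ⦃u v⦄, label u = label v → h u ≤ h v → h (ρ v) ≤ h (ρ u) := by
  classical
  have := Fintype.ofFinite V
  have exists_rev (a : ι) : ∃ σ : Equiv.Perm {v // label v = a},
      ∀ u v : {v // label v = a}, h u ≤ h v → h (σ v) ≤ h (σ u) := by
    let _ : LinearOrder {v // label v = a} := LinearOrder.lift' (fun v => h v)
      fun u v huv => Subtype.ext (hinj (u.2.trans v.2.symm) huv)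
    let e := Fintype.orderIsoFinOfCardEq {v // label v = a} rfl
    refine ⟨e.symm.toEquiv.trans (Fin.revPerm.trans e.toEquiv), fun u v huv => ?_⟩
    exact e.monotone (Fin.rev_le_rev.2 (e.symm.monotone huv))
  choose σ hσ using exists_rev
  let ρ : Equiv.Perm V := (Equiv.sigmaFiberEquiv label).permCongr (Equiv.Perm.sigmaCongrRight σ)
  have hρ : ∀ a (v : {v // label v = a}), ρ v = σ a v := by
    rintro a ⟨v, rfl⟩
    rfl
  refine ⟨ρ, fun v => ?_, fun u v huv hle => ?_⟩
  · exact (congrArg label (hρ _ ⟨v, rfl⟩)).trans (σ _ _).2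
  · have := hσ _ ⟨u, huv⟩ ⟨v, rfl⟩ hle
    rwa [← hρ, ← hρ] at this

section SinkTree

variable {T : Digraph V} {z u v w : V}

/-- The distance of `v` from the root `z`. -/
noncomputable def depth (T : Digraph V) (z v : V) : ℕ := (underlying T).dist v z

namespace IsSinkTree

variable (hT : IsSinkTree T z)

include hT

theorem depth_eq_add_one (h : T.Adj u v) : depth T z u = depth T z v + 1 := hT.2 u v h

theorem depth_eq_zero_iff : depth T z v = 0 ↔ v = z := hT.1.connected.dist_eq_zero_iff

theorem depth_eq_one_of_adj_root (h : T.Adj v z) : depth T z v = 1 := by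
  rw [hT.depth_eq_add_one h, hT.depth_eq_zero_iff.2 rfl]

theorem not_adj_root : ¬ T.Adj z v := fun h => by
  simpa [hT.depth_eq_zero_iff.2 rfl] using hT.depth_eq_add_one h

theorem underlying_adj_of_adj (h : T.Adj u v) : (underlying T).Adj u v := by
  refine ⟨?_, Or.inl h⟩
  rintro rfl
  simpa using hT.depth_eq_add_one h

theorem exists_adj (hu : u ≠ z) : ∃ v, T.Adj u v := by
  obtain ⟨p, hp⟩ := hT.1.connected.exists_walk_length_eq_dist u z
  cases p with
  | nil => exact absurd rfl hu
  | @cons _ v _ huv p =>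
    refine ⟨v, huv.2.resolve_right fun hvu => ?_⟩
    have hdepth := hT.2 v u hvu
    have hdist := SimpleGraph.dist_le p
    rw [SimpleGraph.Walk.length_cons] at hp
    omega

theorem rightUnique_adj : Relator.RightUnique T.Adj := by
  have exists_path {u v : V} (huv : T.Adj u v) :
      ∃ p : (underlying T).Walk u z, p.IsPath ∧ p.snd = v := by
    obtain ⟨p, hp⟩ := hT.1.connected.exists_walk_length_eq_dist v z
    exact ⟨.cons (hT.underlying_adj_of_adj huv) p,
      SimpleGraph.Walk.isPath_of_length_eq_dist _ (by simp [hp, hT.2 u v huv]), by simp⟩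
  intro u v w huv huw
  obtain ⟨p, hp, rfl⟩ := exists_path huv
  obtain ⟨q, hq, rfl⟩ := exists_path huw
  rw [(hT.1.existsUnique_path u z).unique hp hq]

theorem depth_le_of_reflTransGen (h : ReflTransGen T.Adj u v) : depth T z v ≤ depth T z u := by
  induction h with
  | refl => exact le_rfl
  | tail _ hvw ih => have := hT.depth_eq_add_one hvw; omega

theorem eq_of_reflTransGen_of_depth_le (h : ReflTransGen T.Adj u v)
    (hdepth : depth T z u ≤ depth T z v) : u = v := by
  obtain rfl | ⟨w, huw, hwv⟩ := h.cases_head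
  · rfl
  · have := hT.depth_eq_add_one huw
    have := hT.depth_le_of_reflTransGen hwv
    omega

theorem deg_eq_one_of_forall_not_adj (hv : v ≠ z) (hleaf : ∀ u, ¬ T.Adj u v) : deg T v = 1 := by
  obtain ⟨p, hvp⟩ := hT.exists_adj hv
  refine Set.ncard_eq_one.2 ⟨p, Set.eq_singleton_iff_unique_mem.2
    ⟨hT.underlying_adj_of_adj hvp, fun u hu => ?_⟩⟩
  exact hT.rightUnique_adj (hu.2.resolve_right (hleaf u)) hvp

theorem three_le_deg_of_adj_of_adj [Finite V] (hv : v ≠ z) (huv : T.Adj u v) (hwv : T.Adj w v)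
    (huw : u ≠ w) : 3 ≤ deg T v := by
  obtain ⟨p, hvp⟩ := hT.exists_adj hv
  have ne_parent {x : V} (hxv : T.Adj x v) : p ≠ x := by
    rintro rfl
    have := hT.depth_eq_add_one hxv
    have := hT.depth_eq_add_one hvp
    omega
  exact (Set.two_lt_ncard_iff).2 ⟨p, u, w, hT.underlying_adj_of_adj hvp,
    (hT.underlying_adj_of_adj huv).symm, (hT.underlying_adj_of_adj hwv).symm,
    ne_parent huv, ne_parent hwv, huw⟩

theorem nbhd_root : nbhd T z = {v | T.Adj v z} :=
  Set.ext fun _ => ⟨fun h => h.2.resolve_left hT.not_adj_root,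
    fun h => (hT.underlying_adj_of_adj h).symm⟩

end IsSinkTree

end SinkTree

/-- The cars of `s` that do not start at the root `z` can be given distinct parking places, each
car being allowed to move along `r` only. -/
def ParksOffRoot (r : V → V → Prop) (z : V) (s : Fin m → V) : Prop :=
  ∃ f : {i // s i ≠ z} → V, Injective f ∧ ∀ i, r (s i.1) (f i)

/-- A choice of one child `next v` of every vertex `v ≠ z` that has a child; the root and the
leaves are fixed by `next`. It cuts a sink tree into the chains `v, next v, next (next v), …`, each
ending at a leaf, and the chain `{z}`. -/
structure ChildSelection (T : Digraph V) (z : V) where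
  next : V → V
  next_root : next z = z
  adj_next : ∀ {u v : V}, v ≠ z → T.Adj u v → T.Adj (next v) v
  next_eq_self : ∀ {v : V}, (∀ u, ¬ T.Adj u v) → next v = v

theorem nonempty_childSelection (T : Digraph V) (z : V) : Nonempty (ChildSelection T z) := by
  classical
  exact ⟨{
    next := fun v => if h : v ≠ z ∧ ∃ u, T.Adj u v then h.2.choose else v
    next_root := dif_neg fun h => h.1 rfl
    adj_next := fun {u v} hv huv => by
      rw [dif_pos ⟨hv, u, huv⟩]
      exact (⟨u, huv⟩ : ∃ u, T.Adj u v).choose_spec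
    next_eq_self := fun h => dif_neg fun ⟨_, u, hu⟩ => h u hu }⟩

namespace ChildSelection

variable {T : Digraph V} {z : V} (C : ChildSelection T z) {u v : V}

theorem adj_next_of_next_ne (h : C.next v ≠ v) : T.Adj (C.next v) v := by
  have hv : v ≠ z := fun hv => h (hv ▸ C.next_root)
  by_contra hadj
  exact h (C.next_eq_self fun u huv => hadj (C.adj_next hv huv))

theorem reflTransGen_iterate_next (k : ℕ) (v : V) : ReflTransGen T.Adj (C.next^[k] v) v := by
  induction k with
  | zero => exact .refl
  | succ k ih =>
    rw [iterate_succ_apply']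
    by_cases h : C.next (C.next^[k] v) = C.next^[k] v
    · rwa [h]
    · exact ih.head (C.adj_next_of_next_ne h)

/-- The number of vertices of the chain through `v` that are strictly below `v`. -/
noncomputable def height (v : V) : ℕ := sInf {k | IsFixedPt C.next (C.next^[k] v)}

/-- The last vertex of the chain through `v`; it serves as the name of that chain. -/
noncomputable def bottom (v : V) : V := C.next^[C.height v] v

theorem reflTransGen_bottom (v : V) : ReflTransGen T.Adj (C.bottom v) v :=
  C.reflTransGen_iterate_next _ v

theorem bottom_root : C.bottom z = z := iterate_fixed C.next_root _

theorem depth_iterate_next_of_forall_lt (hT : IsSinkTree T z) {k : ℕ}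
    (h : ∀ j < k, ¬ IsFixedPt C.next (C.next^[j] v)) :
    depth T z (C.next^[k] v) = depth T z v + k := by
  induction k with
  | zero => rfl
  | succ k ih =>
    rw [iterate_succ_apply', hT.depth_eq_add_one (C.adj_next_of_next_ne (h k k.lt_succ_self)),
      ih fun j hj => h j (hj.trans k.lt_succ_self), add_assoc]

theorem depth_iterate_next (hT : IsSinkTree T z) {k : ℕ} (hk : k ≤ C.height v) :
    depth T z (C.next^[k] v) = depth T z v + k :=
  C.depth_iterate_next_of_forall_lt hT fun _ hj => Nat.notMem_of_lt_sInf (hj.trans_le hk)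

theorem depth_bottom (hT : IsSinkTree T z) (v : V) :
    depth T z (C.bottom v) = depth T z v + C.height v :=
  C.depth_iterate_next hT le_rfl

theorem eq_root_of_bottom_eq_root (hT : IsSinkTree T z) (h : C.bottom v = z) : v = z := by
  have hdepth := C.depth_bottom hT v
  rw [h, hT.depth_eq_zero_iff.2 rfl] at hdepth
  exact hT.depth_eq_zero_iff.1 (by omega)

theorem eq_of_bottom_eq_of_depth_eq (hT : IsSinkTree T z) (hbottom : C.bottom u = C.bottom v)
    (hdepth : depth T z u = depth T z v) : u = v := by
  rcases ReflTransGen.total_of_right_unique hT.rightUnique_adj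
    (hbottom ▸ C.reflTransGen_bottom u) (C.reflTransGen_bottom v) with huv | hvu
  · exact hT.eq_of_reflTransGen_of_depth_le huv hdepth.le
  · exact (hT.eq_of_reflTransGen_of_depth_le hvu hdepth.ge).symm

theorem edist_iterate_next_le (hT : IsSinkTree T z) (k : ℕ) (v : V) :
    (underlying T).edist (C.next^[k] v) v ≤ k := by
  induction k with
  | zero => simp
  | succ k ih =>
    have hstep : (underlying T).edist (C.next (C.next^[k] v)) (C.next^[k] v) ≤ 1 := by
      rw [SimpleGraph.edist_le_one_iff_adj_or_eq, or_iff_not_imp_right]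
      exact fun h => hT.underlying_adj_of_adj (C.adj_next_of_next_ne h)
    rw [iterate_succ_apply', Nat.cast_add, Nat.cast_one, add_comm]
    exact SimpleGraph.edist_triangle.trans (add_le_add hstep ih)

section Finite

variable [Finite V] (hT : IsSinkTree T z)

include hT

theorem isFixedPt_next_bottom (v : V) : IsFixedPt C.next (C.bottom v) := by
  refine Nat.sInf_mem (s := {k | IsFixedPt C.next (C.next^[k] v)}) ?_
  by_contra hempty
  have hnot (k : ℕ) : ¬ IsFixedPt C.next (C.next^[k] v) := fun hk => hempty ⟨k, hk⟩
  refine not_injective_infinite_finite (fun k : ℕ => C.next^[k] v) fun j k hjk => ?_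
  have hdepth := congrArg (depth T z) hjk
  simp only [C.depth_iterate_next_of_forall_lt hT fun i _ => hnot i] at hdepth
  omega

theorem bottom_next (v : V) : C.bottom (C.next v) = C.bottom v := by
  have hv := (C.isFixedPt_next_bottom hT v).iterate (C.height (C.next v) + 1)
  have hnext := (C.isFixedPt_next_bottom hT (C.next v)).iterate (C.height v)
  have hcomm : C.next^[C.height v] (C.bottom (C.next v)) =
      C.next^[C.height (C.next v) + 1] (C.bottom v) := by
    rw [bottom, ← iterate_succ_apply, bottom, ← iterate_add_apply, ← iterate_add_apply, add_comm]
  exact hnext.symm.trans (hcomm.trans hv)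

theorem bottom_iterate_next (k : ℕ) (v : V) : C.bottom (C.next^[k] v) = C.bottom v := by
  induction k with
  | zero => rfl
  | succ k ih => rw [iterate_succ_apply', C.bottom_next hT, ih]

theorem deg_bottom (hv : v ≠ z) : deg T (C.bottom v) = 1 := by
  have hbottom : C.bottom v ≠ z := fun h => hv (C.eq_root_of_bottom_eq_root hT h)
  refine hT.deg_eq_one_of_forall_not_adj hbottom fun u hu => ?_
  have hloop := hT.depth_eq_add_one (C.adj_next hbottom hu)
  rw [C.isFixedPt_next_bottom hT v] at hloop
  omega

theorem minleafdist_le_height_add_one (hv : v ≠ z) (hdeg : 3 ≤ deg T v) :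
    minleafdist T ≤ C.height v + 1 :=
  calc minleafdist T
    _ ≤ (underlying T).edist (C.bottom v) v + 1 :=
      iInf₂_le_of_le _ (C.deg_bottom hT hv) (iInf₂_le v hdeg)
    _ ≤ C.height v + 1 := by
      gcongr
      exact C.edist_iterate_next_le hT _ v

theorem height_lt_ncard {R : Set V} (hR : Set.MapsTo C.next R R) (hv : v ∈ R) :
    C.height v < R.ncard := by
  have hinj : Set.InjOn (fun k => C.next^[k] v) (Set.Iic (C.height v)) := fun j hj k hk hjk => by
    have hdepth := congrArg (depth T z) hjk
    simpa [C.depth_iterate_next hT hj, C.depth_iterate_next hT hk] using hdepth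
  have hle := Set.ncard_le_ncard_of_injOn _ (fun k _ => hR.iterate k hv) hinj R.toFinite
  rwa [Set.ncard_Iic_nat] at hle

end Finite

/-- The relation "`u` can drive to `v` along their common chain". -/
def Climbs (u v : V) : Prop := C.bottom u = C.bottom v ∧ depth T z v ≤ depth T z u

theorem reflTransGen_of_climbs (hT : IsSinkTree T z) (h : C.Climbs u v) :
    ReflTransGen T.Adj u v := by
  rcases ReflTransGen.total_of_right_unique hT.rightUnique_adj
    (h.1 ▸ C.reflTransGen_bottom u) (C.reflTransGen_bottom v) with huv | hvu
  · exact huv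
  · rw [hT.eq_of_reflTransGen_of_depth_le hvu h.2]

/-- The vertices that lie on the chain of some `a ∈ A`, at `a` or below it. -/
def below (A : Set V) : Set V := {v | ∃ a ∈ A, C.Climbs v a}

theorem subset_below (A : Set V) : A ⊆ C.below A := fun a ha => ⟨a, ha, rfl, le_rfl⟩

theorem root_notMem_below (hT : IsSinkTree T z) {A : Set V} (hA : z ∉ A) : z ∉ C.below A := by
  rintro ⟨a, ha, -, hdepth⟩
  rw [hT.depth_eq_zero_iff.2 rfl, Nat.le_zero, hT.depth_eq_zero_iff] at hdepth
  exact hA (hdepth ▸ ha)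

section Source

variable [Finite V] (hT : IsSinkTree T z)

include hT

theorem mapsTo_next_below (A : Set V) : Set.MapsTo C.next (C.below A) (C.below A) := by
  rintro v ⟨a, ha, hbottom, hdepth⟩
  refine ⟨a, ha, (C.bottom_next hT v).trans hbottom, hdepth.trans ?_⟩
  exact hT.depth_le_of_reflTransGen (C.reflTransGen_iterate_next 1 v)

theorem mem_of_adj_of_ncard_lt {R : Set V} (hR : Set.MapsTo C.next R R) (hz : z ∉ R)
    (hcard : R.ncard < minleafdist T) (hv : v ∈ R) (huv : T.Adj u v) : u ∈ R := by
  have hvz : v ≠ z := ne_of_mem_of_not_mem hv hz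
  by_cases hu : C.next v = u
  · exact hu ▸ hR hv
  · have hdeg := hT.three_le_deg_of_adj_of_adj hvz (C.adj_next hvz huv) huv hu
    have hheight : ((C.height v + 1 : ℕ) : ℕ∞) ≤ R.ncard :=
      Nat.cast_le.2 (C.height_lt_ncard hT hR hv)
    exact absurd (hcard.trans_le (C.minleafdist_le_height_add_one hT hvz hdeg)) hheight.not_gt

theorem mem_of_reflTransGen_of_ncard_lt {R : Set V} (hR : Set.MapsTo C.next R R) (hz : z ∉ R)
    (hcard : R.ncard < minleafdist T) (huv : ReflTransGen T.Adj u v) (hv : v ∈ R) : u ∈ R := by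
  induction huv using ReflTransGen.head_induction_on with
  | refl => exact hv
  | head huw _ hw => exact C.mem_of_adj_of_ncard_lt hT hR hz hcard hw huw

theorem card_le_ncard_below (hmin : m ≤ minleafdist T) {s : Fin m → V}
    (hs : IsParkingFunction (reversal T) s) {A : Finset (Fin m)} (hA : ∀ i ∈ A, s i ≠ z) :
    A.card ≤ (C.below (s '' A)).ncard := by
  obtain ⟨f, hf, hreach⟩ := isParkingFunction_iff_exists_injective.1 hs
  obtain hcard | hcard := le_or_gt m (C.below (s '' A)).ncard
  · exact (card_finset_fin_le A).trans hcard
  have hz : z ∉ s '' A := fun ⟨i, hi, hiz⟩ => hA i hi hiz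
  have hf_mem (i) (hi : i ∈ (A : Set (Fin m))) : f i ∈ C.below (s '' A) :=
    C.mem_of_reflTransGen_of_ncard_lt hT (C.mapsTo_next_below hT _) (C.root_notMem_below hT hz)
      ((Nat.cast_lt.2 hcard).trans_le hmin) (reflTransGen_swap.1 (hreach i))
      (C.subset_below _ ⟨i, hi, rfl⟩)
  rw [← Set.ncard_coe_finset]
  exact Set.ncard_le_ncard_of_injOn f hf_mem hf.injOn (Set.toFinite _)

theorem parksOffRoot_of_isParkingFunction_reversal (hmin : m ≤ minleafdist T) {s : Fin m → V}
    (hs : IsParkingFunction (reversal T) s) : ParksOffRoot (flip C.Climbs) z s := by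
  classical
  have := Fintype.ofFinite V
  refine (Fintype.all_card_le_filter_rel_iff_exists_injective
    fun (i : {i // s i ≠ z}) v => C.Climbs v (s i)).1 fun A => ?_
  have hA : ∀ i ∈ A.map (Embedding.subtype _), s i ≠ z := fun i hi => by
    obtain ⟨j, -, rfl⟩ := Finset.mem_map.1 hi
    exact j.2
  have hHall := C.card_le_ncard_below hT hmin hs hA
  rw [Finset.card_map] at hHall
  convert hHall
  rw [← Set.ncard_coe_finset]
  congr 1
  ext v
  simp [below]

end Source

theorem ncard_parksOffRoot_flip_climbs_le [Finite V] (hT : IsSinkTree T z) (m : ℕ) :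
    {s : Fin m → V | ParksOffRoot (flip C.Climbs) z s}.ncard ≤
      {s : Fin m → V | ParksOffRoot C.Climbs z s}.ncard := by
  obtain ⟨ρ, hρ_bottom, hρ_depth⟩ := exists_perm_antitone_on_fibers C.bottom
    (h := depth T z) fun u v => C.eq_of_bottom_eq_of_depth_eq hT
  have hρ_root : ρ z = z :=
    C.eq_root_of_bottom_eq_root hT ((hρ_bottom z).trans C.bottom_root)
  refine Set.ncard_le_ncard_of_injOn (ρ ∘ ·) ?_ ρ.injective.comp_left.injOn (Set.toFinite _)
  rintro s ⟨f, hf, hs⟩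
  have hz (i : {i // ρ (s i) ≠ z}) : s i ≠ z := fun h => i.2 (by rw [h, hρ_root])
  refine ⟨fun i => ρ (f ⟨i, hz i⟩), fun i j hij => ?_, fun i => ?_⟩
  · simpa [Subtype.ext_iff] using hf (ρ.injective hij)
  · obtain ⟨hbottom, hdepth⟩ := hs ⟨i, hz i⟩
    exact ⟨by simp [hρ_bottom, hbottom], hρ_depth hbottom.symm hdepth⟩

section Sink

variable {s t : Fin m → V} {x y : V}

theorem isParkingFunction_of_parksOffRoot (hT : IsSinkTree T z) (hs : ParksOffRoot C.Climbs z s)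
    (hst : ∀ i, s i ≠ z → t i = s i) {g : {i // s i = z} → V} (hg : Injective g)
    (hreach : ∀ i, ReflTransGen T.Adj (t i.1) (g i))
    (hdisj : ∀ i j, s j ≠ z → C.bottom (g i) ≠ C.bottom (s j)) : IsParkingFunction T t := by
  classical
  obtain ⟨f, hf, hclimb⟩ := hs
  refine isParkingFunction_iff_exists_injective.2
    ⟨fun i => if h : s i = z then g ⟨i, h⟩ else f ⟨i, h⟩, ?_, fun i => ?_⟩
  · refine Injective.dite _ hg hf fun {i j hi hj} hij => ?_
    exact hdisj ⟨i, hi⟩ j hj (hij ▸ (hclimb ⟨j, hj⟩).1.symm)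
  · by_cases h : s i = z
    · simpa only [dif_pos h] using hreach ⟨i, h⟩
    · simpa only [dif_neg h, hst i h] using C.reflTransGen_of_climbs hT (hclimb ⟨i, h⟩)

theorem isParkingFunction_of_subsingleton (hT : IsSinkTree T z)
    (hs : ParksOffRoot C.Climbs z s) (hroot : {i | s i = z}.Subsingleton) :
    IsParkingFunction T s := by
  refine C.isParkingFunction_of_parksOffRoot hT hs (fun _ _ => rfl) (g := fun _ => z)
    (fun i j _ => Subtype.ext (hroot i.2 j.2)) (fun i => by rw [i.2]) fun _ j hj h => ?_
  exact hj (C.eq_root_of_bottom_eq_root hT (h.symm.trans C.bottom_root))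

theorem bottom_ne_root_of_adj_root (hT : IsSinkTree T z) (hx : T.Adj x z) : C.bottom x ≠ z :=
  fun h => hT.not_adj_root (C.eq_root_of_bottom_eq_root hT h ▸ hx)

theorem eq_of_bottom_eq_of_adj_root (hT : IsSinkTree T z) (hx : T.Adj x z) (hy : T.Adj y z)
    (h : C.bottom x = C.bottom y) : x = y :=
  C.eq_of_bottom_eq_of_depth_eq hT h
    ((hT.depth_eq_one_of_adj_root hx).trans (hT.depth_eq_one_of_adj_root hy).symm)

/-- The path that starts at the root and then runs down the chain of `x`, which is meant to be a
child of the root. -/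
def ladder (x : V) : ℕ → V
  | 0 => z
  | k + 1 => C.next^[k] x

theorem depth_ladder (hT : IsSinkTree T z) (hx : T.Adj x z) {k : ℕ} (hk : k ≤ C.height x + 1) :
    depth T z (C.ladder x k) = k := by
  cases k with
  | zero => exact hT.depth_eq_zero_iff.2 rfl
  | succ k =>
    rw [ladder, C.depth_iterate_next hT (by omega), hT.depth_eq_one_of_adj_root hx, add_comm]

theorem reflTransGen_ladder (hx : T.Adj x z) (k : ℕ) :
    ReflTransGen T.Adj (C.next^[k - 1] x) (C.ladder x k) := by
  cases k with
  | zero => exact .single hx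
  | succ k => exact .refl

/-- The sequence `s` with the cars that start at the root sent down the chain of `x`: when they are
numbered `0, 1, 2, 3, …`, their new starting points are `x, x, next x, next (next x), …`. -/
noncomputable def redirect (s : Fin m → V) (x : V) (i : Fin m) : V :=
  open Classical in
  if h : s i = z then C.next^[(Finite.equivFin {i // s i = z} ⟨i, h⟩ : ℕ) - 1] x else s i

theorem redirect_of_eq (i : {i // s i = z}) :
    C.redirect s x i = C.next^[(Finite.equivFin {i // s i = z} i : ℕ) - 1] x := dif_pos i.2

theorem redirect_of_ne {i : Fin m} (h : s i ≠ z) : C.redirect s x i = s i := dif_neg h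

theorem nontrivial_redirect_eq (hroot : {i | s i = z}.Nontrivial) :
    {i | C.redirect s x i = x}.Nontrivial := by
  have hcard : 1 < Nat.card {i // s i = z} := Set.one_lt_ncard_iff_nontrivial.2 hroot
  let e := Finite.equivFin {i // s i = z}
  refine ⟨e.symm ⟨0, by omega⟩, ?_, e.symm ⟨1, hcard⟩, ?_, ?_⟩
  · simp [redirect_of_eq, e]
  · simp [redirect_of_eq, e]
  · simp [Subtype.val_inj]

theorem subsingleton_eq_of_parksOffRoot (hT : IsSinkTree T z) (hs : ParksOffRoot C.Climbs z s)
    (hx : T.Adj x z) : {i | s i = x}.Subsingleton := by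
  obtain ⟨f, hf, hclimb⟩ := hs
  have hf_eq (i : {i // s i ≠ z}) (hi : s i = x) : f i = x := by
    obtain ⟨hbottom, hdepth⟩ := hi ▸ hclimb i
    have hfz : f i ≠ z := fun h =>
      C.bottom_ne_root_of_adj_root hT hx (by rw [hbottom, h, C.bottom_root])
    have hf_depth := mt hT.depth_eq_zero_iff.1 hfz
    have hx_depth := hT.depth_eq_one_of_adj_root hx
    exact C.eq_of_bottom_eq_of_depth_eq hT hbottom.symm (by omega)
  have hxz : x ≠ z := fun h => hT.not_adj_root (h ▸ hx)
  intro i hi j hj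
  have hi' : s i ≠ z := fun h => hxz (hi.symm.trans h)
  have hj' : s j ≠ z := fun h => hxz (hj.symm.trans h)
  exact congrArg Subtype.val (hf ((hf_eq ⟨i, hi'⟩ hi).trans (hf_eq ⟨j, hj'⟩ hj).symm))

/-- The pairs `(s, x)` to which `redirect` is applied: at least two cars of `s` start at the root,
and no car of `s` starts on the chain of the child `x` of the root. -/
def redirectable (m : ℕ) : Set ((Fin m → V) × V) :=
  {p | ParksOffRoot C.Climbs z p.1 ∧ {i | p.1 i = z}.Nontrivial ∧ T.Adj p.2 z ∧
    ∀ i, C.bottom (p.1 i) ≠ C.bottom p.2}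

theorem not_parksOffRoot_redirect (hT : IsSinkTree T z) (h : (s, x) ∈ C.redirectable m) :
    ¬ ParksOffRoot C.Climbs z (C.redirect s x) := fun hs =>
  Set.not_subsingleton_iff.2 (C.nontrivial_redirect_eq h.2.1)
    (C.subsingleton_eq_of_parksOffRoot hT hs h.2.2.1)

section Finite

variable [Finite V] (hT : IsSinkTree T z)

include hT

theorem bottom_ladder_eq (x : V) (k : ℕ) :
    C.bottom (C.ladder x k) = z ∨ C.bottom (C.ladder x k) = C.bottom x := by
  cases k with
  | zero => exact .inl C.bottom_root
  | succ k => exact .inr (C.bottom_iterate_next hT k x)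

theorem isParkingFunction_redirect (h : (s, x) ∈ C.redirectable m) (hm : m ≤ C.height x + 2) :
    IsParkingFunction T (C.redirect s x) := by
  obtain ⟨hs, -, hx, hfree⟩ := h
  let e := Finite.equivFin {i // s i = z}
  have he (i) : (e i : ℕ) ≤ C.height x + 1 := by
    have := Finite.card_subtype_le fun i => s i = z
    rw [Nat.card_fin] at this
    have := (e i).isLt
    omega
  refine C.isParkingFunction_of_parksOffRoot hT hs (fun _ => C.redirect_of_ne)
    (g := fun i => C.ladder x (e i)) (fun i j hij => ?_) (fun i => ?_) fun i j hj hij => ?_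
  · have hdepth := congrArg (depth T z) hij
    rw [C.depth_ladder hT hx (he i), C.depth_ladder hT hx (he j)] at hdepth
    exact e.injective (Fin.ext hdepth)
  · rw [C.redirect_of_eq]
    exact C.reflTransGen_ladder hx _
  · rcases C.bottom_ladder_eq hT x (e i) with hz | hxb
    · exact hj (C.eq_root_of_bottom_eq_root hT (hij.symm.trans hz))
    · exact hfree j (hij.symm.trans hxb)

theorem bottom_redirect_eq_iff (hfree : ∀ i, C.bottom (s i) ≠ C.bottom x) {i : Fin m} :
    C.bottom (C.redirect s x i) = C.bottom x ↔ s i = z := by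
  by_cases h : s i = z
  · simpa only [h, iff_true] using
      (congrArg C.bottom (C.redirect_of_eq ⟨i, h⟩)).trans (C.bottom_iterate_next hT _ x)
  · simpa only [h, iff_false, C.redirect_of_ne h] using hfree i

theorem injOn_redirect :
    Set.InjOn (fun p : (Fin m → V) × V => C.redirect p.1 p.2) (C.redirectable m) := by
  rintro ⟨s, x⟩ ⟨-, hroot, hx, hfree⟩ ⟨t, y⟩ ⟨ht, -, hy, hfree'⟩
    (heq : C.redirect s x = C.redirect t y)
  obtain rfl : x = y := by
    by_contra hxy
    have hsub : {i | C.redirect s x i = x} ⊆ {i | t i = x} := fun i (hi : _ = x) => by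
      have hti : t i ≠ z := fun h => hxy <| C.eq_of_bottom_eq_of_adj_root hT hx hy <| by
        rw [← (C.bottom_redirect_eq_iff hT hfree').2 h, ← heq, hi]
      rwa [heq, C.redirect_of_ne hti] at hi
    exact Set.not_subsingleton_iff.2 ((C.nontrivial_redirect_eq hroot).mono hsub)
      (C.subsingleton_eq_of_parksOffRoot hT ht hx)
  refine Prod.ext (funext fun i => show s i = t i from ?_) rfl
  have hst : s i = z ↔ t i = z := by
    rw [← C.bottom_redirect_eq_iff hT hfree, heq, C.bottom_redirect_eq_iff hT hfree']
  by_cases h : s i = z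
  · exact h.trans (hst.1 h).symm
  · rw [← C.redirect_of_ne (x := x) h, heq, C.redirect_of_ne (mt hst.2 h)]

end Finite

theorem exists_mem_redirectable (hT : IsSinkTree T z) (hm : m ≤ {x | T.Adj x z}.ncard + 1)
    (hs : ParksOffRoot C.Climbs z s) (hroot : {i | s i = z}.Nontrivial) :
    ∃ x, (s, x) ∈ C.redirectable m := by
  by_contra! hnone
  have hcar (x) (hx : T.Adj x z) : ∃ i, C.bottom (s i) = C.bottom x := by
    by_contra! hfree
    exact hnone x ⟨hs, hroot, hx, hfree⟩
  have : Nonempty (Fin m) := ⟨hroot.nonempty.some⟩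
  choose! car hcar using hcar
  have hcard : {x | T.Adj x z}.ncard ≤ {i | s i = z}ᶜ.ncard := by
    refine Set.ncard_le_ncard_of_injOn car (fun x hx hi => ?_) fun x hx y hy hxy => ?_
    · have hbottom := hcar x hx
      rw [show s (car x) = z from hi, C.bottom_root] at hbottom
      exact C.bottom_ne_root_of_adj_root hT hx hbottom.symm
    · exact C.eq_of_bottom_eq_of_adj_root hT hx hy (by rw [← hcar x hx, hxy, hcar y hy])
  have htwo := Set.one_lt_ncard_iff_nontrivial.2 hroot
  have htotal := Set.ncard_add_ncard_compl {i | s i = z}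
  rw [Nat.card_fin] at htotal
  omega

theorem const_mem_redirectable (hT : IsSinkTree T z) (hm : 2 ≤ m) (hx : T.Adj x z) :
    (fun _ => z, x) ∈ C.redirectable m := by
  have : Nontrivial (Fin m) := Fin.nontrivial_iff_two_le.2 hm
  refine ⟨⟨fun i => absurd rfl i.2, fun i => absurd rfl i.2, fun i => absurd rfl i.2⟩, ?_, hx,
    fun _ h => ?_⟩
  · simpa using Set.nontrivial_univ
  · exact C.bottom_ne_root_of_adj_root hT hx (h.symm.trans C.bottom_root)

end Sink

section Count

variable [Finite V] (hT : IsSinkTree T z)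

include hT

theorem minleafdist_le_height_add_two {x : V} (hx : T.Adj x z) (hdeg : 3 ≤ deg T z) :
    minleafdist T ≤ C.height x + 2 := by
  have hxz : x ≠ z := fun h => hT.not_adj_root (h ▸ hx)
  calc minleafdist T
    _ ≤ (underlying T).edist (C.bottom x) z + 1 :=
      iInf₂_le_of_le _ (C.deg_bottom hT hxz) (iInf₂_le z hdeg)
    _ ≤ (underlying T).edist (C.bottom x) x + (underlying T).edist x z + 1 := by
      gcongr
      exact SimpleGraph.edist_triangle
    _ ≤ C.height x + 1 + 1 := by
      gcongr
      · exact C.edist_iterate_next_le hT _ x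
      · exact SimpleGraph.edist_le_one_iff_adj_or_eq.2 (.inl (hT.underlying_adj_of_adj hx))
    _ = C.height x + 2 := by rw [add_assoc, one_add_one_eq_two]

theorem ncard_fst_redirectable_lt (hm : 2 ≤ m) (hdeg : 2 ≤ deg T z) :
    (Prod.fst '' C.redirectable m).ncard < (C.redirectable m).ncard := by
  rw [deg, hT.nbhd_root] at hdeg
  obtain ⟨x, hx, y, hy, hxy⟩ := Set.one_lt_ncard_iff_nontrivial.1 hdeg
  refine (Set.ncard_image_le (Set.toFinite _)).lt_of_ne fun heq => hxy ?_
  have hinj := Set.injOn_of_ncard_image_eq heq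
  exact congrArg Prod.snd (hinj (C.const_mem_redirectable hT hm hx)
    (C.const_mem_redirectable hT hm hy) rfl)

theorem ncard_parksOffRoot_climbs_lt (hm : 2 ≤ m) (hdeg : 2 ≤ deg T z) (hdeg' : m ≤ deg T z + 1)
    (hheight : ∀ x, T.Adj x z → m ≤ C.height x + 2) :
    {s : Fin m → V | ParksOffRoot C.Climbs z s}.ncard < numParking T m := by
  rw [numParking, Set.ncard_lt_ncard_iff_ncard_sdiff_lt_ncard_sdiff]
  calc _
    _ ≤ (Prod.fst '' C.redirectable m).ncard := by
      refine Set.ncard_le_ncard fun s ⟨hs, hpark⟩ => ?_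
      have hroot : {i | s i = z}.Nontrivial := by
        by_contra h
        exact hpark (C.isParkingFunction_of_subsingleton hT hs (Set.not_nontrivial_iff.1 h))
      rw [deg, hT.nbhd_root] at hdeg'
      obtain ⟨x, hx⟩ := C.exists_mem_redirectable hT hdeg' hs hroot
      exact ⟨(s, x), hx, rfl⟩
    _ < (C.redirectable m).ncard := C.ncard_fst_redirectable_lt hT hm hdeg
    _ ≤ _ := by
      refine Set.ncard_le_ncard_of_injOn (fun p => C.redirect p.1 p.2) (fun ⟨s, x⟩ h => ?_)
        (C.injOn_redirect hT)
      exact ⟨C.isParkingFunction_redirect hT h (hheight x h.2.2.1),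
        C.not_parksOffRoot_redirect hT h⟩

end Count

end ChildSelection

end DigraphParking

open DigraphParking in
theorem mainTheorem3_general {V : Type*} [Finite V] {T : Digraph V} {z : V} {m : ℕ}
    (hT : IsSinkTree T z) (hm : 2 ≤ m) (hdeg : min m 3 ≤ deg T z) (hdeg' : m ≤ deg T z + 1)
    (hmin : m ≤ minleafdist T) : numParking (reversal T) m < numParking T m := by
  obtain ⟨C⟩ := nonempty_childSelection T z
  have hheight (x) (hx : T.Adj x z) : m ≤ C.height x + 2 := by
    by_cases hz : 3 ≤ deg T z
    · exact_mod_cast hmin.trans (C.minleafdist_le_height_add_two hT hx hz)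
    · omega
  calc numParking (reversal T) m
    _ ≤ {s : Fin m → V | ParksOffRoot (flip C.Climbs) z s}.ncard :=
      Set.ncard_le_ncard fun _ => C.parksOffRoot_of_isParkingFunction_reversal hT hmin
    _ ≤ {s : Fin m → V | ParksOffRoot C.Climbs z s}.ncard :=
      C.ncard_parksOffRoot_flip_climbs_le hT m
    _ < numParking T m := C.ncard_parksOffRoot_climbs_lt hT hm (by omega) hdeg' hheight

theorem mainTheorem3 (n m : ℕ) (T : Digraph (Fin n)) (z : Fin n)
    (hT : DigraphParking.IsSinkTree T z) (hm : 2 ≤ m)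
    (hmin : (m : ℕ∞) ≤ min ((DigraphParking.nbhd T z).ncard : ℕ∞) (DigraphParking.minleafdist T)) :
    DigraphParking.numParking (DigraphParking.reversal T) m < DigraphParking.numParking T m := by
  obtain ⟨hdeg, hleaf⟩ := le_min_iff.1 hmin
  have hdeg : m ≤ DigraphParking.deg T z := Nat.cast_le.1 hdeg
  exact mainTheorem3_general hT hm (by omega) (by omega) hleaf
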